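/- Let $\mathbb K\in\{\mathbb R,\mathbb C\}$. For integers $m,n\ge 0$ let $\mathscr O^m_n(\mathbb R)$ be the space of all $f\in C^m(\mathbb R)$ with values in $\mathbb K$ such that $$|f|_{m,n}:=\sup_{x\in\mathbb R,\;0\le j\le m}(1+|x|^2)^{-n}|f^{(j)}(x)|<\infty ,$$ normed by $|\cdot|_{m,n}$; let $\mathscr O^m(\mathbb R)=\bigcup_n\mathscr O^m_n(\mathbb R)$ carry the locally convex inductive limit topology of these normed spaces, and let $\mathscr O_M(\mathbb R)=\bigcap_m\mathscr O^m(\mathbb R)$ carry the projective limit topology of the spaces $\mathscr O^m(\mathbb R)$, $m\ge 0$. **Theorem.** Let $\psi:\mathbb R\to\mathbb R$ be a real-valued function in $\mathscr O_M(\mathbb R)$ that is bijective and satisfies $\psi(x)>x$ and $\psi'(x)>0$ for every $x\in\mathbb R$. For $n\ge 1$ let $\psi_n$ be the $n$-fold composition of $\psi$ with itself and let $\psi_{-n}$ be the inverse function of $\psi_n$. Assume that there are $\alpha,\beta\in\mathbb R$ such that 1. for every integer $j\ge 1$ there are $C_j>0$ and $t_j\in\mathbb N$ such that $|(\psi_{-n})^{(j)}(x)|\le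 C_j(1+|x|^2)^{t_j}$ for all $x\in(\beta,\infty)$ and all $n\ge 1$, and 2. for every integer $j\ge 1$ there are $C_j>0$ and $t_j\in\mathbb N$ such that $|(\psi_{n})^{(j)}(x)|\le C_j(1+|x|^2)^{t_j}$ for all $x\in(-\infty,\alpha)$ and all $n\ge 1$. Then the composition operator $C_\psi:\mathscr O_M(\mathbb R)\to\mathscr O_M(\mathbb R)$, $f\mapsto f\circ\psi$, is sequentially hypercyclic: there is $g\in\mathscr O_M(\mathbb R)$ whose orbit $\{C_\psi^n g:n=0,1,2,\dots\}$ is sequentially dense, i.e. every $f\in\mathscr O_M(\mathbb R)$ is the limit in $\mathscr O_M(\mathbb R)$ of a sequence of elements of this orbit. -/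

import Mathlib

open scoped ContDiff

noncomputable section

namespace SlowlyIncreasing

/-- The weighted size `(1 + |x|²)⁻ⁿ |f⁽ʲ⁾(x)|`. -/
def weighted {𝕜 : Type*} [RCLike 𝕜] (n : ℕ) (f : ℝ → 𝕜) (j : ℕ) (x : ℝ) : ℝ :=
  ((1 + |x| ^ 2) ^ n)⁻¹ * ‖iteratedDeriv j f x‖

/-- `f ∈ Cᵐ(ℝ)` and the quantities `(1 + |x|²)⁻ⁿ |f⁽ʲ⁾(x)|`, `x ∈ ℝ`, `0 ≤ j ≤ m`, are bounded. -/
def IsStep {𝕜 : Type*} [RCLike 𝕜] (m n : ℕ) (f : ℝ → 𝕜) : Prop :=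
  ContDiff ℝ m f ∧
    BddAbove (Set.range fun p : Fin (m + 1) × ℝ => weighted n f p.1 p.2)

section helpers

variable {𝕜 : Type*} [RCLike 𝕜]

theorem weighted_nonneg (n : ℕ) (f : ℝ → 𝕜) (j : ℕ) (x : ℝ) : 0 ≤ weighted n f j x := by
  unfold weighted; positivity

theorem weighted_add_le {m : ℕ} (n : ℕ) {f g : ℝ → 𝕜} (hf : ContDiff ℝ m f) (hg : ContDiff ℝ m g)
    (j : Fin (m + 1)) (x : ℝ) :
    weighted n (f + g) j x ≤ weighted n f j x + weighted n g j x := by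
  have hj : ((j : ℕ) : WithTop ℕ∞) ≤ (m : WithTop ℕ∞) := by
    exact_mod_cast Nat.lt_succ_iff.1 j.2
  unfold weighted
  rw [iteratedDeriv_add (hf.contDiffAt.of_le hj) (hg.contDiffAt.of_le hj), ← mul_add]
  gcongr
  exact norm_add_le _ _

theorem weighted_smul (n : ℕ) (c : 𝕜) (f : ℝ → 𝕜) (j : ℕ) (x : ℝ) :
    weighted n (c • f) j x = ‖c‖ * weighted n f j x := by
  unfold weighted
  have h : iteratedDeriv j (c • f) x = c • iteratedDeriv j f x := by
    rw [iteratedDeriv_const_smul_field]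
  rw [h, norm_smul]
  ring

theorem weighted_zero (n : ℕ) (j : ℕ) (x : ℝ) : weighted n (0 : ℝ → 𝕜) j x = 0 := by
  simpa using weighted_smul n (0 : 𝕜) (0 : ℝ → 𝕜) j x

theorem weighted_neg (n : ℕ) (f : ℝ → 𝕜) (j : ℕ) (x : ℝ) :
    weighted n (-f) j x = weighted n f j x := by
  simpa using weighted_smul n (-1 : 𝕜) f j x

theorem IsStep.zero (m n : ℕ) : IsStep m n (0 : ℝ → 𝕜) :=
  ⟨contDiff_const, 0, by rintro _ ⟨p, rfl⟩; exact (weighted_zero n p.1 p.2).le⟩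

theorem IsStep.add {m n : ℕ} {f g : ℝ → 𝕜} (hf : IsStep m n f) (hg : IsStep m n g) :
    IsStep m n (f + g) := by
  obtain ⟨hf, A, hA⟩ := hf
  obtain ⟨hg, B, hB⟩ := hg
  refine ⟨hf.add hg, A + B, ?_⟩
  rintro _ ⟨p, rfl⟩
  exact (weighted_add_le n hf hg p.1 p.2).trans (add_le_add (hA ⟨p, rfl⟩) (hB ⟨p, rfl⟩))

theorem IsStep.smul {m n : ℕ} (c : 𝕜) {f : ℝ → 𝕜} (hf : IsStep m n f) : IsStep m n (c • f) := by
  obtain ⟨hf, A, hA⟩ := hf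
  refine ⟨hf.const_smul c, ‖c‖ * A, ?_⟩
  rintro _ ⟨p, rfl⟩
  simp only [weighted_smul]
  exact mul_le_mul_of_nonneg_left (hA ⟨p, rfl⟩) (norm_nonneg c)

theorem IsStep.mono {m n n' : ℕ} (h : n ≤ n') {f : ℝ → 𝕜} (hf : IsStep m n f) :
    IsStep m n' f := by
  obtain ⟨hf, A, hA⟩ := hf
  refine ⟨hf, A, ?_⟩
  rintro _ ⟨p, rfl⟩
  refine le_trans ?_ (hA ⟨p, rfl⟩)
  simp only [weighted]
  gcongr
  exact le_add_of_nonneg_right (by positivity)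

end helpers

/-- The vector space `𝒪ₙᵐ(ℝ)` of `𝕜`-valued functions. -/
def stepSubmodule (𝕜 : Type*) [RCLike 𝕜] (m n : ℕ) : Submodule 𝕜 (ℝ → 𝕜) where
  carrier := {f | IsStep m n f}
  zero_mem' := IsStep.zero m n
  add_mem' := IsStep.add
  smul_mem' c _ hf := IsStep.smul c hf

/-- The vector space `𝒪ᵐ(ℝ) = ⋃ₙ 𝒪ₙᵐ(ℝ)`. -/
def levelSubmodule (𝕜 : Type*) [RCLike 𝕜] (m : ℕ) : Submodule 𝕜 (ℝ → 𝕜) where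
  carrier := {f | ∃ n, IsStep m n f}
  zero_mem' := ⟨0, IsStep.zero m 0⟩
  add_mem' := by
    rintro f g ⟨n, hf⟩ ⟨n', hg⟩
    exact ⟨max n n', (hf.mono (le_max_left _ _)).add (hg.mono (le_max_right _ _))⟩
  smul_mem' := by
    rintro c f ⟨n, hf⟩
    exact ⟨n, hf.smul c⟩

/-- The vector space `𝒪_M(ℝ) = ⋂ₘ ⋃ₙ 𝒪ₙᵐ(ℝ)`. -/
def omSubmodule (𝕜 : Type*) [RCLike 𝕜] : Submodule 𝕜 (ℝ → 𝕜) :=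
  ⨅ m, levelSubmodule 𝕜 m

/-! The three spaces are separate types, so that they do not inherit the topology of pointwise
convergence from `ℝ → 𝕜`. -/

/-- The Banach space `𝒪ₙᵐ(ℝ)`. -/
def Step (𝕜 : Type*) [RCLike 𝕜] (m n : ℕ) : Type _ := ↥(stepSubmodule 𝕜 m n)

/-- The (LB)-space `𝒪ᵐ(ℝ)`. -/
def Level (𝕜 : Type*) [RCLike 𝕜] (m : ℕ) : Type _ := ↥(levelSubmodule 𝕜 m)

/-- The locally convex space `𝒪_M(ℝ)`. -/
def OM (𝕜 : Type*) [RCLike 𝕜] : Type _ := ↥(omSubmodule 𝕜)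

section spaces

variable (𝕜 : Type*) [RCLike 𝕜] (m n : ℕ)

instance : AddCommGroup (Level 𝕜 m) := inferInstanceAs (AddCommGroup ↥(levelSubmodule 𝕜 m))
instance : Module 𝕜 (Level 𝕜 m) := inferInstanceAs (Module 𝕜 ↥(levelSubmodule 𝕜 m))
instance : Module ℝ (Level 𝕜 m) := inferInstanceAs (Module ℝ ↥(levelSubmodule 𝕜 m))
instance : AddCommGroup (OM 𝕜) := inferInstanceAs (AddCommGroup ↥(omSubmodule 𝕜))
instance : Module 𝕜 (OM 𝕜) := inferInstanceAs (Module 𝕜 ↥(omSubmodule 𝕜))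

/-- The norm `|f|_{m,n} = sup_{x ∈ ℝ, 0 ≤ j ≤ m} (1 + |x|²)⁻ⁿ |f⁽ʲ⁾(x)|` on `𝒪ₙᵐ(ℝ)`. -/
def stepNorm : AddGroupNorm ↥(stepSubmodule 𝕜 m n) where
  toFun f := ⨆ p : Fin (m + 1) × ℝ, weighted n f.1 p.1 p.2
  map_zero' := by
    simp [weighted_zero]
  add_le' f g := by
    refine ciSup_le fun p => (weighted_add_le n f.2.1 g.2.1 p.1 p.2).trans ?_
    exact add_le_add (le_ciSup f.2.2 p) (le_ciSup g.2.2 p)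
  neg' f := by
    simp [weighted_neg]
  eq_zero_of_map_eq_zero' f hf := by
    ext x
    have h := le_ciSup f.2.2 ((0 : Fin (m + 1)), x)
    have h0 : weighted n f.1 0 x = 0 :=
      le_antisymm (h.trans hf.le) (weighted_nonneg n f.1 0 x)
    have h1 : ((1 + |x| ^ 2) ^ n)⁻¹ ≠ (0 : ℝ) := by positivity
    simpa using (mul_eq_zero.1 h0).resolve_left h1

instance : NormedAddCommGroup (Step 𝕜 m n) := (stepNorm 𝕜 m n).toNormedAddCommGroup

/-- The inclusion `𝒪ₙᵐ(ℝ) → 𝒪ᵐ(ℝ)`. -/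
def stepToLevel (f : Step 𝕜 m n) : Level 𝕜 m := ⟨f.1, n, f.2⟩

/-- The inclusion `𝒪_M(ℝ) → 𝒪ᵐ(ℝ)`. -/
def omToLevel (f : OM 𝕜) : Level 𝕜 m := ⟨f.1, Submodule.mem_iInf _ |>.1 f.2 m⟩

/-- The inductive limit topology of `𝒪ᵐ(ℝ) = ind_n 𝒪ₙᵐ(ℝ)` in the category of locally convex
spaces: the finest locally convex vector space topology for which all the inclusions
`𝒪ₙᵐ(ℝ) → 𝒪ᵐ(ℝ)` are continuous. -/
instance : TopologicalSpace (Level 𝕜 m) :=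
  sInf {t : TopologicalSpace (Level 𝕜 m) |
    (∀ n, @Continuous (Step 𝕜 m n) (Level 𝕜 m) _ t (stepToLevel 𝕜 m n)) ∧
    @IsTopologicalAddGroup (Level 𝕜 m) t _ ∧
    @ContinuousSMul 𝕜 (Level 𝕜 m) _ _ t ∧
    @LocallyConvexSpace ℝ (Level 𝕜 m) _ _ _ _ t}

/-- The projective limit topology of `𝒪_M(ℝ) = proj_m 𝒪ᵐ(ℝ)`: the coarsest topology for which all
the inclusions `𝒪_M(ℝ) → 𝒪ᵐ(ℝ)` are continuous. -/
instance : TopologicalSpace (OM 𝕜) :=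
  ⨅ m, TopologicalSpace.induced (omToLevel 𝕜 m) inferInstance

end spaces

section composition

variable {𝕜 : Type*} [RCLike 𝕜]

theorem mem_omSubmodule_iff (f : ℝ → 𝕜) : f ∈ omSubmodule 𝕜 ↔ f.HasTemperateGrowth := by
  have hmem : f ∈ omSubmodule 𝕜 ↔ ∀ m, ∃ n, IsStep m n f := Submodule.mem_iInf _
  rw [hmem]
  constructor
  · intro h
    refine ⟨contDiff_infty.2 fun m => (h m).choose_spec.1, fun j => ?_⟩
    obtain ⟨n, -, A, hA⟩ := h j
    refine ⟨2 * n, A, fun x => ?_⟩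
    have hx : weighted n f j x ≤ A := hA ⟨(Fin.last j, x), rfl⟩
    have hA0 : 0 ≤ A := (weighted_nonneg n f j x).trans hx
    unfold weighted at hx
    rw [norm_iteratedFDeriv_eq_norm_iteratedDeriv]
    rw [inv_mul_le_iff₀ (by positivity), mul_comm] at hx
    refine hx.trans ?_
    rw [pow_mul, Real.norm_eq_abs]
    gcongr
    nlinarith [abs_nonneg x]
  · intro h m
    obtain ⟨k, C, hC, hb⟩ := h.norm_iteratedFDeriv_le_uniform m
    refine ⟨k, h.1.of_le (by exact_mod_cast le_top), C * 2 ^ k, ?_⟩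
    rintro _ ⟨⟨j, x⟩, rfl⟩
    have hx := hb j (Nat.lt_succ_iff.1 j.2) x
    rw [norm_iteratedFDeriv_eq_norm_iteratedDeriv, Real.norm_eq_abs] at hx
    simp only [weighted]
    rw [inv_mul_le_iff₀ (by positivity)]
    refine hx.trans ?_
    have h2 : (1 + |x|) ^ k ≤ (2 * (1 + |x| ^ 2)) ^ k := by
      gcongr
      nlinarith [sq_nonneg (|x| - 1), sq_nonneg |x|]
    calc C * (1 + |x|) ^ k ≤ C * (2 * (1 + |x| ^ 2)) ^ k := by gcongr
      _ = (1 + |x| ^ 2) ^ k * (C * 2 ^ k) := by rw [mul_pow]; ring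

theorem comp_mem_omSubmodule {f : ℝ → 𝕜} {ψ : ℝ → ℝ} (hf : f ∈ omSubmodule 𝕜)
    (hψ : ψ ∈ omSubmodule ℝ) : f ∘ ψ ∈ omSubmodule 𝕜 :=
  (mem_omSubmodule_iff _).2
    (((mem_omSubmodule_iff f).1 hf).comp ((mem_omSubmodule_iff ψ).1 hψ))

variable (𝕜) in
/-- The composition operator `C_ψ : 𝒪_M(ℝ) → 𝒪_M(ℝ)`, `f ↦ f ∘ ψ`, with symbol `ψ ∈ 𝒪_M(ℝ)`. -/
def compositionOperator (ψ : ℝ → ℝ) (hψ : ψ ∈ omSubmodule ℝ) : OM 𝕜 →ₗ[𝕜] OM 𝕜 where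
  toFun f := ⟨f.1 ∘ ψ, comp_mem_omSubmodule f.2 hψ⟩
  map_add' _ _ := rfl
  map_smul' _ _ := rfl

end composition

/-- `T` is sequentially hypercyclic: there is a vector `g` whose orbit `{g, T g, T² g, …}` is
sequentially dense, i.e. every vector is the limit of a sequence of elements of the orbit. -/
def IsSeqHypercyclic {𝕜 E : Type*} [Semiring 𝕜] [AddCommMonoid E] [Module 𝕜 E]
    [TopologicalSpace E] (T : E →ₗ[𝕜] E) : Prop :=
  ∃ g : E, seqClosure (Set.range fun n : ℕ => (T ^ n) g) = Set.univ

/-- The iterate `ψ_n`, `n ∈ ℤ`, of a bijection `ψ`: the `n`-fold composition of `ψ` with itself for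
`n ≥ 0`, and the inverse function of `ψ_{-n}` for `n < 0`. -/
def iter (ψ : ℝ → ℝ) (hψ : Function.Bijective ψ) (n : ℤ) : ℝ → ℝ :=
  ⇑((Equiv.ofBijective ψ hψ : Equiv.Perm ℝ) ^ n)

end SlowlyIncreasing

end

open Filter Topology

namespace SlowlyIncreasing

/-! Since `ψ` has no fixed point and moves points to the right, `ψ_n → ∞` pointwise. So for a test
function `f` supported in `[-r, r]`, the support of `f ∘ ψ_{-n}` runs off to `+∞` and that of `f ∘
ψ_n` to `-∞`; the derivative bounds are therefore only needed near the respective end. By Faà di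
Bruno the `j`-th derivative of either composition is at most a constant depending on `f` times a
power of `1 + |x|²` depending only on `j`. One more factor `1 + |x|²`, large on the escaping
support, absorbs that constant, so both compositions tend to zero in a weight independent of `f`
(`exists_eventually_comp_le`).

Now take a sequence `d k` of test functions, sequentially dense in `𝒪_M` (`exists_seq_dense`), and
put `g = ∑ d k ∘ ψ_{-N k}` with `N` growing fast (`exists_orbit_approximating`). The sum is locally
finite, and because the weights do not depend on `k` it lies in `𝒪_M`. In `g ∘ ψ_{N k}` the `k`-th
term is `d k`, and all others are pushed far to one side or the other, hence small. Thus `g ∘ ψ_{N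
k} - d k` is null in the sense of `IsNull`, which is stronger than convergence in `𝒪_M`
(`IsNull.tendsto`). -/

/-- The sequence of functions `u` tends to zero in the following strong sense: for every `j` the
`j`-th derivatives tend to zero uniformly after division by a fixed power of `1 + |x|²`. -/
def IsNull {𝕜 : Type*} [RCLike 𝕜] (u : ℕ → ℝ → 𝕜) : Prop :=
  ∀ j, ∃ n : ℕ, ∀ ε > 0, ∀ᶠ i in atTop, ∀ x, ‖iteratedDeriv j (u i) x‖ ≤ ε * (1 + |x| ^ 2) ^ n

/-! ### Null sequences and convergence in `𝒪_M` -/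

section null

variable {𝕜 : Type*} [RCLike 𝕜]

theorem one_add_sq_pow_mono (x : ℝ) {n n' : ℕ} (h : n ≤ n') :
    (1 + |x| ^ 2) ^ n ≤ (1 + |x| ^ 2) ^ n' :=
  pow_le_pow_right₀ (le_add_of_nonneg_right (by positivity)) h

theorem one_le_one_add_sq_pow (x : ℝ) (n : ℕ) : 1 ≤ (1 + |x| ^ 2) ^ n :=
  one_le_pow₀ (le_add_of_nonneg_right (by positivity))

theorem IsNull.add {u v : ℕ → ℝ → 𝕜} (hu : IsNull u) (hv : IsNull v)
    (hu' : ∀ i, ContDiff ℝ ∞ (u i)) (hv' : ∀ i, ContDiff ℝ ∞ (v i)) :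
    IsNull (fun i => u i + v i) := by
  intro j
  obtain ⟨n, hn⟩ := hu j
  obtain ⟨n', hn'⟩ := hv j
  refine ⟨max n n', fun ε hε => ?_⟩
  filter_upwards [hn (ε / 2) (half_pos hε), hn' (ε / 2) (half_pos hε)] with i h h' x
  have hj : ((j : ℕ) : WithTop ℕ∞) ≤ ∞ := by exact_mod_cast le_top
  rw [iteratedDeriv_add ((hu' i).contDiffAt.of_le hj) ((hv' i).contDiffAt.of_le hj)]
  calc _ ≤ ε / 2 * (1 + |x| ^ 2) ^ n + ε / 2 * (1 + |x| ^ 2) ^ n' :=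
        (norm_add_le _ _).trans (add_le_add (h x) (h' x))
    _ ≤ ε / 2 * (1 + |x| ^ 2) ^ max n n' + ε / 2 * (1 + |x| ^ 2) ^ max n n' := by
        gcongr ε / 2 * ?_ + ε / 2 * ?_
        · exact one_add_sq_pow_mono x (le_max_left _ _)
        · exact one_add_sq_pow_mono x (le_max_right _ _)
    _ = _ := by ring

theorem IsNull.comp_tendsto {u : ℕ → ℝ → 𝕜} (hu : IsNull u) {a : ℕ → ℕ}
    (ha : Tendsto a atTop atTop) : IsNull (fun i => u (a i)) := by
  intro j
  obtain ⟨n, hn⟩ := hu j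
  exact ⟨n, fun ε hε => ha.eventually (hn ε hε)⟩

/-- In a null sequence, the estimates hold with a common weight for all derivatives up to a given
order. -/
theorem IsNull.uniform {u : ℕ → ℝ → 𝕜} (hu : IsNull u) (m : ℕ) :
    ∃ n : ℕ, ∀ ε > 0, ∀ᶠ i in atTop, ∀ j ≤ m, ∀ x,
      ‖iteratedDeriv j (u i) x‖ ≤ ε * (1 + |x| ^ 2) ^ n := by
  choose n hn using hu
  refine ⟨(Finset.range (m + 1)).sup n, fun ε hε => ?_⟩
  have := (Finset.eventually_all (Finset.range (m + 1))).2 fun j _ => hn j ε hε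
  filter_upwards [this] with i hi j hj x
  have hj' : j ∈ Finset.range (m + 1) := by simpa [Nat.lt_succ_iff] using hj
  refine (hi j hj' x).trans ?_
  gcongr ε * ?_
  exact one_add_sq_pow_mono x (Finset.le_sup hj')

/-- Kept abstract so that it applies to each competing topology in the infimum defining the
inductive limit; only continuity of translations is used. -/
theorem tendsto_of_eventually_eq_add {S E : Type*} [TopologicalSpace S] [Zero S] [AddCommGroup E]
    [TopologicalSpace E] [IsTopologicalAddGroup E] {ι : S → E} (hι : Continuous ι) (h0 : ι 0 = 0)
    {v : ℕ → S} (hv : Tendsto v atTop (𝓝 0)) {F : ℕ → E} {f : E}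
    (h : ∀ᶠ i in atTop, ι (v i) + f = F i) : Tendsto F atTop (𝓝 f) := by
  have h1 : Tendsto (fun i => ι (v i) + f) atTop (𝓝 (ι 0 + f)) :=
    ((hι.tendsto 0).comp hv).add_const f
  rw [h0, zero_add] at h1
  exact h1.congr' h

theorem isStep_of_bound {m n : ℕ} {f : ℝ → 𝕜} (hf : ContDiff ℝ m f) {ε : ℝ}
    (h : ∀ j ≤ m, ∀ x, ‖iteratedDeriv j f x‖ ≤ ε * (1 + |x| ^ 2) ^ n) :
    IsStep m n f ∧ ∀ p : Fin (m + 1) × ℝ, weighted n f p.1 p.2 ≤ ε := by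
  have : ∀ p : Fin (m + 1) × ℝ, weighted n f p.1 p.2 ≤ ε := fun p => by
    unfold weighted
    rw [inv_mul_le_iff₀ (by positivity), mul_comm]
    exact h p.1 (Nat.lt_succ_iff.1 p.1.2) p.2
  exact ⟨⟨hf, ε, by rintro _ ⟨p, rfl⟩; exact this p⟩, this⟩

theorem OM.hasTemperateGrowth (f : OM 𝕜) : f.1.HasTemperateGrowth :=
  (mem_omSubmodule_iff _).1 f.2

/-- A sequence whose difference with `f` is null converges to `f` in `𝒪_M(ℝ)`. -/
theorem IsNull.tendsto {F : ℕ → OM 𝕜} {f : OM 𝕜} (h : IsNull fun i => (F i).1 - f.1) :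
    Tendsto F atTop (𝓝 f) := by
  classical
  rw [nhds_iInf, tendsto_iInf]
  intro m
  -- Convergence for an infimum of topologies is convergence for each member `t` of the family.
  rw [nhds_induced, tendsto_comap_iff, nhds_sInf, tendsto_iInf]
  intro t
  rw [tendsto_iInf]
  rintro ⟨hc, hg, -, -⟩
  obtain ⟨n, hn⟩ := h.uniform m
  have hsm : ∀ i, ContDiff ℝ m ((F i).1 - f.1) := fun i =>
    ((F i).hasTemperateGrowth.1.sub f.hasTemperateGrowth.1).of_le (by exact_mod_cast le_top)
  let v : ℕ → Step 𝕜 m n := fun i =>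
    if hi : IsStep m n ((F i).1 - f.1) then ⟨(F i).1 - f.1, hi⟩ else 0
  have hv : Tendsto v atTop (𝓝 0) := by
    rw [NormedAddGroup.tendsto_nhds_zero]
    intro ε hε
    filter_upwards [hn (ε / 2) (half_pos hε)] with i hi
    obtain ⟨h1, h2⟩ := isStep_of_bound (hsm i) hi
    have hvi : v i = ⟨(F i).1 - f.1, h1⟩ := dif_pos h1
    rw [hvi]
    refine lt_of_le_of_lt ?_ (half_lt_self hε)
    exact ciSup_le h2
  refine @tendsto_of_eventually_eq_add (Step 𝕜 m n) (Level 𝕜 m) _ _ _ t hg _ (hc n) rfl v hv _ _ ?_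
  filter_upwards [hn 1 one_pos] with i hi
  obtain ⟨h1, -⟩ := isStep_of_bound (hsm i) hi
  have hvi : v i = ⟨(F i).1 - f.1, h1⟩ := dif_pos h1
  rw [hvi]
  apply Subtype.ext
  change ((F i).1 - f.1) + f.1 = (F i).1
  simp

end null

/-! ### A sequentially dense sequence of test functions -/

section dense

variable {𝕜 : Type*} [RCLike 𝕜]

theorem iteratedDeriv_eq_zero_of_eventually {f : ℝ → 𝕜} {x : ℝ} (h : ∀ᶠ y in 𝓝 x, f y = 0)
    (j : ℕ) : iteratedDeriv j f x = 0 := by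
  have h' : f =ᶠ[𝓝 x] fun _ => (0 : 𝕜) := h
  rw [h'.iteratedDeriv_eq j]
  simp

theorem eventually_lt_abs {R x : ℝ} (h : R < |x|) : ∀ᶠ y in 𝓝 x, R < |y| :=
  (continuous_abs.tendsto x).eventually_const_lt h

/-- The smooth functions vanishing off `[-R, R]` contain a sequence which is dense with respect to
uniform convergence of all derivatives. -/
theorem exists_dense_seq_vanishing_off (𝕜 : Type*) [RCLike 𝕜] (R : ℝ) :
    ∃ d : ℕ → ℝ → 𝕜, (∀ k, ContDiff ℝ ∞ (d k)) ∧ (∀ k x, R < |x| → d k x = 0) ∧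
      ∀ f : ℝ → 𝕜, ContDiff ℝ ∞ f → (∀ x, R < |x| → f x = 0) → ∀ m : ℕ, ∀ ε > 0, ∃ k,
        ∀ j ≤ m, ∀ x, ‖iteratedDeriv j (d k - f) x‖ ≤ ε := by
  let E := {h : ℝ → 𝕜 // ContDiff ℝ ∞ h ∧ ∀ x, R < |x| → h x = 0}
  have hle : ∀ j : ℕ, (j : WithTop ℕ∞) ≤ ∞ := fun j => by exact_mod_cast le_top
  let Φ : E → ℕ → C(ℝ, 𝕜) := fun h j =>
    ⟨iteratedDeriv j h.1, h.2.1.continuous_iteratedDeriv j (hle j)⟩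
  -- With the topology induced from the countable product of the second countable spaces `C(ℝ, 𝕜)`,
  -- `E` is second countable, hence separable.
  let _ : TopologicalSpace E := TopologicalSpace.induced Φ inferInstance
  have : SecondCountableTopology E := TopologicalSpace.secondCountableTopology_induced E _ Φ
  have : Nonempty E := ⟨⟨0, contDiff_const, fun _ _ => rfl⟩⟩
  refine ⟨fun k => (TopologicalSpace.denseSeq E k).1, fun k => (TopologicalSpace.denseSeq E k).2.1,
    fun k => (TopologicalSpace.denseSeq E k).2.2, fun f hf hf0 m ε hε => ?_⟩
  obtain ⟨s, hs, hlim⟩ := mem_closure_iff_seq_limit.1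
    (TopologicalSpace.denseRange_denseSeq E (⟨f, hf, hf0⟩ : E))
  have hΦ : Continuous Φ := continuous_induced_dom
  have h1 : ∀ j, ∀ᶠ p in atTop, ∀ x ∈ Set.Icc (-R) R,
      dist (iteratedDeriv j f x) (iteratedDeriv j (s p).1 x) < ε := fun j => by
    have h2 : Tendsto (fun p => Φ (s p) j) atTop (𝓝 (Φ ⟨f, hf, hf0⟩ j)) :=
      ((continuous_apply j).comp hΦ).continuousAt.tendsto.comp hlim
    rw [ContinuousMap.tendsto_iff_forall_isCompact_tendstoUniformlyOn] at h2
    exact Metric.tendstoUniformlyOn_iff.1 (h2 _ isCompact_Icc) ε hε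
  obtain ⟨p, hp⟩ := ((Finset.eventually_all (Finset.range (m + 1))).2 fun j _ => h1 j).exists
  obtain ⟨k, hk⟩ := hs p
  refine ⟨k, fun j hj x => ?_⟩
  simp only [hk]
  rcases le_or_gt |x| R with hx | hx
  · have := hp j (by simpa [Nat.lt_succ_iff] using hj) x (abs_le.1 hx)
    rw [iteratedDeriv_sub ((s p).2.1.contDiffAt.of_le (hle j)) (hf.contDiffAt.of_le (hle j)),
      ← dist_eq_norm, dist_comm]
    exact this.le
  · rw [iteratedDeriv_eq_zero_of_eventually, norm_zero]
    · exact hε.le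
    · filter_upwards [eventually_lt_abs hx] with y hy
      simp [(s p).2.2 y hy, hf0 y hy]

/-- A smooth function with bounded derivatives that vanishes near the origin and is one near
infinity. -/
theorem exists_smooth_vanishing_near_zero : ∃ ρ : ℝ → ℝ, ContDiff ℝ ∞ ρ ∧
    (∀ x, |x| < 1 → ρ x = 0) ∧ (∀ x, 2 < |x| → ρ x = 1) ∧
    ∀ j, ∃ B, ∀ x, ‖iteratedDeriv j ρ x‖ ≤ B := by
  let χ : ContDiffBump (0 : ℝ) := ⟨1, 2, one_pos, one_lt_two⟩
  have hχ : ContDiff ℝ ∞ χ := χ.contDiff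
  refine ⟨fun x => 1 - χ x, contDiff_const.sub hχ, fun x hx => ?_, fun x hx => ?_, fun j => ?_⟩
  · beta_reduce
    rw [χ.one_of_mem_closedBall (by simpa using hx.le), sub_self]
  · beta_reduce
    rw [χ.zero_of_le_dist (by simpa using hx.le), sub_zero]
  · have hj : ((j : ℕ) : WithTop ℕ∞) ≤ ∞ := by exact_mod_cast le_top
    obtain ⟨B, hB⟩ := (hχ.continuous_iteratedFDeriv hj).bounded_above_of_compact_support
      (χ.hasCompactSupport.iteratedFDeriv (𝕜 := ℝ) j)
    refine ⟨1 + B, fun x => ?_⟩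
    have : iteratedDeriv j (fun x => 1 - χ x) x
        = iteratedDeriv j (fun _ => (1 : ℝ)) x - iteratedDeriv j χ x :=
      iteratedDeriv_sub contDiffAt_const (hχ.contDiffAt.of_le hj)
    rw [this]
    refine (norm_sub_le _ _).trans (add_le_add ?_ ?_)
    · rw [iteratedDeriv_const]; split_ifs <;> simp
    · rw [← norm_iteratedFDeriv_eq_norm_iteratedDeriv]; exact hB x

theorem HasTemperateGrowth.exists_bound {f : ℝ → 𝕜} (hf : f.HasTemperateGrowth) (m : ℕ) :
    ∃ n : ℕ, ∃ C, 0 ≤ C ∧ ∀ j ≤ m, ∀ x, ‖iteratedDeriv j f x‖ ≤ C * (1 + |x| ^ 2) ^ n := by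
  obtain ⟨n, -, A, hA⟩ := (Submodule.mem_iInf _).1 ((mem_omSubmodule_iff f).2 hf) m
  have key : ∀ j ≤ m, ∀ x, ‖iteratedDeriv j f x‖ ≤ A * (1 + |x| ^ 2) ^ n := fun j hj x => by
    have : weighted n f j x ≤ A := hA ⟨(⟨j, Nat.lt_succ_iff.2 hj⟩, x), rfl⟩
    unfold weighted at this
    rwa [inv_mul_le_iff₀ (by positivity), mul_comm] at this
  refine ⟨n, A, ?_, key⟩
  simpa using (norm_nonneg _).trans (key 0 (Nat.zero_le _) 0)

/-- Every `f ∈ 𝒪_M(ℝ)` is a limit of smooth functions with compact support. -/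
theorem exists_cutoff_seq {f : ℝ → 𝕜} (hf : f.HasTemperateGrowth) :
    ∃ F : ℕ → ℝ → 𝕜, (∀ i, ContDiff ℝ ∞ (F i)) ∧ (∀ i, ∀ x, ((2 * (i + 1) : ℕ) : ℝ) < |x| → F i x = 0) ∧
      IsNull (fun i => F i - f) := by
  obtain ⟨ρ, hρ, hρ0, hρ1, hB⟩ := exists_smooth_vanishing_near_zero
  choose B hB using hB
  have hρi : ∀ i : ℕ, ContDiff ℝ ∞ (fun x => ρ (((i : ℝ) + 1)⁻¹ * x)) := fun i =>
    hρ.comp (contDiff_const.mul contDiff_id)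
  have hsm : ∀ i : ℕ, ContDiff ℝ ∞ (fun x => ρ (((i : ℝ) + 1)⁻¹ * x) • f x) := fun i =>
    (hρi i).smul hf.1
  have habs : ∀ (i : ℕ) (x : ℝ), |((i : ℝ) + 1)⁻¹ * x| = |x| / (i + 1) := fun i x => by
    rw [abs_mul, abs_of_pos (by positivity), div_eq_inv_mul]
  refine ⟨fun i => f - fun x => ρ (((i : ℝ) + 1)⁻¹ * x) • f x, fun i => hf.1.sub (hsm i),
    fun i x hx => ?_, fun j => ?_⟩
  · have : ρ (((i : ℝ) + 1)⁻¹ * x) = 1 := hρ1 _ (by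
      rw [habs, lt_div_iff₀ (by positivity)]; push_cast at hx; exact hx)
    simp [this]
  · have hj : ((j : ℕ) : WithTop ℕ∞) ≤ ∞ := by exact_mod_cast le_top
    obtain ⟨n, C, hC, hfb⟩ := HasTemperateGrowth.exists_bound hf j
    have hB0 : ∀ l, 0 ≤ B l := fun l => (norm_nonneg _).trans (hB l 0)
    set K := ∑ l ∈ Finset.range (j + 1), (j.choose l : ℝ) * B l * C with hK
    have hK0 : 0 ≤ K := Finset.sum_nonneg fun l _ => by have := hB0 l; positivity
    -- The extra power gives smallness: the difference vanishes for `|x| < i + 1`, and elsewhere `1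
    -- + |x|² ≥ i₀ ≥ K / ε`.
    refine ⟨n + 1, fun ε hε => ?_⟩
    obtain ⟨i₀, hi₀⟩ := exists_nat_ge (K / ε)
    filter_upwards [eventually_ge_atTop i₀] with i hi x
    have hsub : (f - fun x => ρ (((i : ℝ) + 1)⁻¹ * x) • f x) - f
        = -fun x => ρ (((i : ℝ) + 1)⁻¹ * x) • f x := by abel
    simp only [hsub]
    rw [iteratedDeriv_neg, norm_neg]
    rcases lt_or_ge |x| (i + 1) with hx | hx
    · rw [iteratedDeriv_eq_zero_of_eventually, norm_zero]
      · positivity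
      · filter_upwards [(continuous_abs.tendsto x).eventually_lt_const hx] with y hy
        rw [hρ0 _ (by rwa [habs, div_lt_one (by positivity)]), zero_smul]
    · have h1 : ‖iteratedDeriv j (fun x => ρ (((i : ℝ) + 1)⁻¹ * x) • f x) x‖
          ≤ K * (1 + |x| ^ 2) ^ n := by
        rw [← norm_iteratedFDeriv_eq_norm_iteratedDeriv]
        refine (norm_iteratedFDeriv_smul_le (hρi i) hf.1 x hj).trans ?_
        rw [hK, Finset.sum_mul]
        refine Finset.sum_le_sum fun l hl => ?_
        rw [norm_iteratedFDeriv_eq_norm_iteratedDeriv, norm_iteratedFDeriv_eq_norm_iteratedDeriv,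
          mul_assoc _ C]
        have hl' : ((l : ℕ) : WithTop ℕ∞) ≤ ∞ := by exact_mod_cast le_top
        have h2 : ‖iteratedDeriv l (fun x => ρ (((i : ℝ) + 1)⁻¹ * x)) x‖ ≤ B l := by
          -- Rescaling only contributes the factor `(i + 1)⁻ˡ ≤ 1`, so the bounds are uniform in
          -- `i`.
          rw [iteratedDeriv_comp_const_mul (hρ.of_le hl'), norm_mul, norm_pow]
          refine (mul_le_of_le_one_left (norm_nonneg _) (pow_le_one₀ (norm_nonneg _) ?_)).trans
            (hB l _)
          rw [norm_inv, Real.norm_of_nonneg (by positivity)]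
          exact inv_le_one_of_one_le₀ (le_add_of_nonneg_left (by positivity))
        gcongr
        · exact mul_nonneg (by positivity) (hB0 l)
        · exact hfb _ (Nat.sub_le _ _) x
      refine h1.trans ?_
      rw [pow_succ _ n, mul_comm ((1 + |x| ^ 2) ^ n), ← mul_assoc]
      gcongr
      have hi' : (i₀ : ℝ) ≤ i := by exact_mod_cast hi
      rw [div_le_iff₀ hε] at hi₀
      have h3 : (1 : ℝ) ≤ |x| := le_trans (by linarith [(Nat.cast_nonneg i : (0 : ℝ) ≤ i)]) hx
      have h4 : (i₀ : ℝ) ≤ 1 + |x| ^ 2 := by nlinarith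
      calc K ≤ i₀ * ε := hi₀
        _ ≤ (1 + |x| ^ 2) * ε := by gcongr
        _ = _ := mul_comm _ _

/-- There is a sequence of smooth functions with compact support which is sequentially dense in
`𝒪_M(ℝ)`, and every limit can be realised along indices tending to infinity. -/
theorem exists_seq_dense (𝕜 : Type*) [RCLike 𝕜] :
    ∃ d : ℕ → ℝ → 𝕜, (∀ k, ContDiff ℝ ∞ (d k)) ∧ (∀ k, ∃ r : ℝ, ∀ x, r < |x| → d k x = 0) ∧
      ∀ f : ℝ → 𝕜, f.HasTemperateGrowth →
        ∃ a : ℕ → ℕ, Tendsto a atTop atTop ∧ IsNull (fun i => d (a i) - f) := by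
  choose D hD hD0 hdense using fun R : ℕ => exists_dense_seq_vanishing_off 𝕜 (R : ℝ)
  -- The index codes a triple (tag, radius, position). The ignored tag makes every function occur
  -- infinitely often, which lets the chosen indices tend to infinity.
  refine ⟨fun k => D k.unpair.2.unpair.1 k.unpair.2.unpair.2, fun k => hD _ _,
    fun k => ⟨_, hD0 _ _⟩, fun f hf => ?_⟩
  obtain ⟨F, hF, hF0, hFf⟩ := exists_cutoff_seq hf
  choose b hb using fun i : ℕ =>
    hdense (2 * (i + 1)) (F i) (hF i) (hF0 i) i (1 / ((i : ℝ) + 1)) (by positivity)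
  refine ⟨fun i => Nat.pair i (Nat.pair (2 * (i + 1)) (b i)),
    tendsto_atTop_mono (fun i => Nat.left_le_pair _ _) tendsto_id, ?_⟩
  simp only [Nat.unpair_pair]
  have h1 : IsNull fun i => D (2 * (i + 1)) (b i) - F i := fun j => by
    refine ⟨0, fun ε hε => ?_⟩
    have hlim : ∀ᶠ i : ℕ in atTop, 1 / ((i : ℝ) + 1) < ε :=
      tendsto_one_div_add_atTop_nhds_zero_nat.eventually_lt_const hε
    filter_upwards [hlim, eventually_ge_atTop j] with i hi hij x
    simpa using (hb i j hij x).trans (by simpa using hi.le)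
  have := h1.add hFf (fun i => (hD _ _).sub (hF i)) (fun i => (hF i).sub hf.1)
  simpa using this

end dense

/-! ### Estimates for compositions with iterates -/

section composition_estimates

variable {𝕜 : Type*} [RCLike 𝕜]

theorem natCast_le_infty (j : ℕ) : (j : WithTop ℕ∞) ≤ ∞ := by exact_mod_cast le_top

/-- If the derivatives of the `φ n` are bounded on `U` by powers of `1 + |x|²`, uniformly in `n`,
then so are the derivatives of `f ∘ φ n`, with constants depending on bounds for the derivatives
of `f` only. -/
theorem exists_comp_bound (𝕜 : Type*) [RCLike 𝕜] {φ : ℕ → ℝ → ℝ} {U : Set ℝ}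
    (hφ : ∀ n, ContDiff ℝ ∞ (φ n))
    (h : ∀ j : ℕ, 1 ≤ j → ∃ C : ℝ, 0 < C ∧ ∃ t : ℕ, ∀ x ∈ U, ∀ n : ℕ, 1 ≤ n →
      |iteratedDeriv j (φ n) x| ≤ C * (1 + |x| ^ 2) ^ t) (j : ℕ) :
    ∃ A : ℝ, ∃ s : ℕ, 0 < A ∧ ∀ f : ℝ → 𝕜, ContDiff ℝ ∞ f → ∀ M : ℝ,
      (∀ i ≤ j, ∀ y, ‖iteratedDeriv i f y‖ ≤ M) → ∀ n, 1 ≤ n → ∀ x ∈ U,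
        ‖iteratedDeriv j (f ∘ φ n) x‖ ≤ M * (A * (1 + |x| ^ 2) ^ s) := by
  have h' : ∀ i : ℕ, ∃ C : ℝ, ∃ t : ℕ, 0 < C ∧ (1 ≤ i → ∀ x ∈ U, ∀ n : ℕ, 1 ≤ n →
      |iteratedDeriv i (φ n) x| ≤ C * (1 + |x| ^ 2) ^ t) := fun i => by
    by_cases hi : 1 ≤ i
    · obtain ⟨C, hC, t, ht⟩ := h i hi
      exact ⟨C, t, hC, fun _ => ht⟩
    · exact ⟨1, 0, one_pos, fun h => absurd h hi⟩
  choose C t hC hb using h'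
  -- The summand `1` ensures `D ≥ 1`: the Faà di Bruno estimate wants the `i`-th derivative bounded
  -- by an `i`-th power.
  set D := 1 + ∑ i ∈ Finset.range (j + 1), C i
  set T := (Finset.range (j + 1)).sup t
  have hD1 : 1 ≤ D := le_add_of_nonneg_right (Finset.sum_nonneg fun i _ => (hC i).le)
  refine ⟨j.factorial * D ^ j, T * j, by positivity, fun f hf M hM n hn x hx => ?_⟩
  rw [← norm_iteratedFDeriv_eq_norm_iteratedDeriv]
  have key := norm_iteratedFDeriv_comp_le hf (hφ n) (natCast_le_infty j) x
    (C := M) (D := D * (1 + |x| ^ 2) ^ T)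
    (fun i hi => by rw [norm_iteratedFDeriv_eq_norm_iteratedDeriv]; exact hM i hi _)
    (fun i hi hij => by
      rw [norm_iteratedFDeriv_eq_norm_iteratedDeriv, Real.norm_eq_abs]
      have hi' : i ∈ Finset.range (j + 1) := by simpa [Nat.lt_succ_iff] using hij
      have hCi : C i ≤ D := (Finset.single_le_sum (fun i _ => (hC i).le) hi').trans
        (le_add_of_nonneg_left zero_le_one)
      calc _ ≤ C i * (1 + |x| ^ 2) ^ t i := hb i hi x hx n hn
        _ ≤ D * (1 + |x| ^ 2) ^ T :=
          mul_le_mul hCi (one_add_sq_pow_mono x (Finset.le_sup hi')) (by positivity) (by positivity)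
        _ ≤ _ := le_self_pow₀ (one_le_mul_of_one_le_of_one_le hD1 (one_le_one_add_sq_pow x T))
          (by omega))
  refine key.trans (le_of_eq ?_)
  rw [mul_pow, ← pow_mul]
  ring

theorem exists_bound_of_vanishing_off {f : ℝ → 𝕜} (hf : ContDiff ℝ ∞ f) {K : Set ℝ}
    (hK : IsCompact K) (hf0 : ∀ x, x ∉ K → f x = 0) (j : ℕ) :
    ∃ M, 0 ≤ M ∧ ∀ x, ‖iteratedDeriv j f x‖ ≤ M := by
  have hc : HasCompactSupport f := HasCompactSupport.intro hK (fun {x} hx => hf0 x hx)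
  obtain ⟨M, hM⟩ := (hf.continuous_iteratedFDeriv (natCast_le_infty j)).bounded_above_of_compact_support
    (hc.iteratedFDeriv (𝕜 := ℝ) j)
  refine ⟨M, (norm_nonneg _).trans (hM 0), fun x => ?_⟩
  rw [← norm_iteratedFDeriv_eq_norm_iteratedDeriv]
  exact hM x

/-- If moreover the sets `{x | |φ n x| ≤ r}` escape to infinity inside `U`, then `f ∘ φ n` tends to
zero for every smooth `f` with compact support, with respect to a weight independent of `f`. -/
theorem exists_eventually_comp_le (𝕜 : Type*) [RCLike 𝕜] {φ : ℕ → ℝ → ℝ} {U : Set ℝ}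
    (hφ : ∀ n, ContDiff ℝ ∞ (φ n))
    (h : ∀ j : ℕ, 1 ≤ j → ∃ C : ℝ, 0 < C ∧ ∃ t : ℕ, ∀ x ∈ U, ∀ n : ℕ, 1 ≤ n →
      |iteratedDeriv j (φ n) x| ≤ C * (1 + |x| ^ 2) ^ t)
    (hesc : ∀ r L : ℝ, ∀ᶠ n in atTop, ∀ x, |φ n x| ≤ r → x ∈ U ∧ L ≤ |x|) (j : ℕ) :
    ∃ s : ℕ, ∀ f : ℝ → 𝕜, ContDiff ℝ ∞ f → ∀ r, (∀ x, r < |x| → f x = 0) → ∀ ε > 0,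
      ∀ᶠ n in atTop, ∀ x, ‖iteratedDeriv j (f ∘ φ n) x‖ ≤ ε * (1 + |x| ^ 2) ^ s := by
  obtain ⟨A, s, hA, hb⟩ := exists_comp_bound 𝕜 hφ h j
  refine ⟨s + 1, fun f hf r hf0 ε hε => ?_⟩
  choose M hM0 hM using exists_bound_of_vanishing_off hf (isCompact_Icc (a := -r) (b := r))
    (fun x hx => hf0 x (by rw [Set.mem_Icc, ← abs_le] at hx; exact not_le.1 hx))
  set m := ∑ i ∈ Finset.range (j + 1), M i
  have hm : ∀ i ≤ j, ∀ y, ‖iteratedDeriv i f y‖ ≤ m := fun i hi y =>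
    (hM i y).trans (Finset.single_le_sum (fun i _ => hM0 i) (by simpa [Nat.lt_succ_iff] using hi))
  -- On the preimage of the support, `1 + |x|² ≥ |x| ≥ m * A / ε` trades the constant `m * A` for
  -- `ε`.
  filter_upwards [hesc r (m * A / ε), eventually_ge_atTop 1] with n hn hn1 x
  rcases le_or_gt |φ n x| r with hx | hx
  · obtain ⟨hxU, hxL⟩ := hn x hx
    refine (hb f hf m hm n hn1 x hxU).trans ?_
    rw [pow_succ _ s, ← mul_assoc, mul_comm ((1 + |x| ^ 2) ^ s), ← mul_assoc]
    refine mul_le_mul_of_nonneg_right ?_ (by positivity)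
    rw [div_le_iff₀ hε] at hxL
    have : |x| ≤ 1 + |x| ^ 2 := by nlinarith [sq_nonneg (|x| - 1)]
    nlinarith
  · rw [iteratedDeriv_eq_zero_of_eventually, norm_zero]
    · positivity
    · have := (continuous_abs.comp (hφ n).continuous).tendsto x
      filter_upwards [this.eventually_const_lt hx] with y hy
      exact hf0 _ hy

end composition_estimates

/-! ### Construction of the universal function -/

section universal

variable {𝕜 : Type*} [RCLike 𝕜]

theorem norm_iteratedDeriv_sum_le {I : Finset ℕ} {v : ℕ → ℝ → 𝕜} (hv : ∀ l, ContDiff ℝ ∞ (v l))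
    {f : ℝ → 𝕜} {x : ℝ} (hf : ∀ᶠ y in 𝓝 x, f y = ∑ l ∈ I, v l y) (j : ℕ) :
    ‖iteratedDeriv j f x‖ ≤ ∑ l ∈ I, ‖iteratedDeriv j (v l) x‖ := by
  have h : f =ᶠ[𝓝 x] fun y => ∑ l ∈ I, v l y := hf
  rw [h.iteratedDeriv_eq j,
    iteratedDeriv_fun_sum fun l _ => (hv l).contDiffAt.of_le (natCast_le_infty j)]
  exact norm_sum_le _ _

/-- The sum of a sequence of functions such that the `k`-th one vanishes on `(-∞, k]`. -/
noncomputable def locSum (u : ℕ → ℝ → 𝕜) (x : ℝ) : 𝕜 := ∑ k ∈ Finset.range (⌊x⌋₊ + 1), u k x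

/-- Indices beyond `⌊x⌋₊` contribute nothing at `x`. The condition `K ≠ 0` matters for negative `x`,
where the natural floor is `0` and the sum still contains the term `k = 0`. -/
theorem locSum_eq {u : ℕ → ℝ → 𝕜} (hu : ∀ (k : ℕ) (x : ℝ), x ≤ k → u k x = 0) {x : ℝ} {K : ℕ}
    (hK : K ≠ 0) (hx : x < K) : locSum u x = ∑ k ∈ Finset.range K, u k x := by
  refine Finset.sum_subset (fun k hk => ?_) fun k _ hk => hu k x ?_
  · have := (Nat.floor_lt' hK).2 hx
    simp only [Finset.mem_range] at hk ⊢
    omega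
  · simp only [Finset.mem_range, not_lt] at hk
    exact ((Nat.lt_floor_add_one x).trans_le (by exact_mod_cast hk)).le

theorem eventually_locSum_eq {u : ℕ → ℝ → 𝕜} (hu : ∀ (k : ℕ) (x : ℝ), x ≤ k → u k x = 0) {x : ℝ} {K : ℕ}
    (hK : K ≠ 0) (hx : x < K) : ∀ᶠ y in 𝓝 x, locSum u y = ∑ k ∈ Finset.range K, u k y := by
  filter_upwards [eventually_lt_nhds hx] with y hy
  exact locSum_eq hu hK hy

theorem contDiff_locSum {u : ℕ → ℝ → 𝕜} (hu : ∀ (k : ℕ) (x : ℝ), x ≤ k → u k x = 0)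
    (hsm : ∀ k, ContDiff ℝ ∞ (u k)) : ContDiff ℝ ∞ (locSum u) := by
  rw [contDiff_iff_contDiffAt]
  intro x
  obtain ⟨K, hK⟩ := exists_nat_gt x
  have h := eventually_locSum_eq hu K.succ_ne_zero (hK.trans (by push_cast; linarith))
  exact (ContDiffAt.sum fun k _ => (hsm k).contDiffAt).congr_of_eventuallyEq h

/-- A locally finite sum of smooth functions whose derivatives are eventually dominated by a
geometric series lies in `𝒪_M(ℝ)`. -/
theorem hasTemperateGrowth_locSum {u : ℕ → ℝ → 𝕜} (hu : ∀ (k : ℕ) (x : ℝ), x ≤ k → u k x = 0)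
    (hsm : ∀ k, ContDiff ℝ ∞ (u k)) (hbd : ∀ k j, ∃ M, 0 ≤ M ∧ ∀ x, ‖iteratedDeriv j (u k) x‖ ≤ M)
    {s : ℕ → ℕ} (hle : ∀ k, ∀ j ≤ k, ∀ x,
      ‖iteratedDeriv j (u k) x‖ ≤ (1 / 2) ^ k * (1 + |x| ^ 2) ^ s j) :
    (locSum u).HasTemperateGrowth := by
  refine ⟨contDiff_locSum hu hsm, fun j => ?_⟩
  choose M hM0 hM using hbd
  set B := ∑ k ∈ Finset.range j, M k j
  refine ⟨2 * s j, B + 2, fun x => ?_⟩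
  rw [norm_iteratedFDeriv_eq_norm_iteratedDeriv]
  obtain ⟨K, hK⟩ := exists_nat_gt x
  -- The range must pass `x` and also contain all `k < j`, the terms without a geometric bound at
  -- order `j`, which `B` collects.
  have h := eventually_locSum_eq hu (K := K + j + 1) (Nat.succ_ne_zero _)
    (hK.trans_le (by push_cast; linarith [(Nat.cast_nonneg j : (0 : ℝ) ≤ j)]))
  have hB : 0 ≤ B := Finset.sum_nonneg fun k _ => hM0 k j
  have hterm : ∀ k, ‖iteratedDeriv j (u k) x‖ ≤
      ((if k < j then M k j else 0) + (1 / 2) ^ k) * (1 + |x| ^ 2) ^ s j := fun k => by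
    split_ifs with hkj
    · refine (hM k j x).trans ((le_mul_of_one_le_right (hM0 k j) (one_le_one_add_sq_pow x (s j))).trans ?_)
      gcongr
      exact le_add_of_nonneg_right (by positivity)
    · rw [zero_add]
      exact hle k j (not_lt.1 hkj) x
  have hsum : ∑ k ∈ Finset.range (K + j + 1), (if k < j then M k j else 0) = B := by
    rw [← Finset.sum_filter]
    congr 1
    ext k
    simp only [Finset.mem_filter, Finset.mem_range]
    omega
  calc ‖iteratedDeriv j (locSum u) x‖ ≤ _ := norm_iteratedDeriv_sum_le hsm h j
    _ ≤ ∑ k ∈ Finset.range (K + j + 1),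
        ((if k < j then M k j else 0) + (1 / 2) ^ k) * (1 + |x| ^ 2) ^ s j :=
      Finset.sum_le_sum fun k _ => hterm k
    _ ≤ (B + 2) * (1 + |x| ^ 2) ^ s j := by
      rw [← Finset.sum_mul, Finset.sum_add_distrib, hsum]
      gcongr
      exact sum_geometric_two_le _
    _ ≤ (B + 2) * (1 + ‖x‖) ^ (2 * s j) := by
      rw [pow_mul, Real.norm_eq_abs]
      gcongr
      nlinarith [abs_nonneg x]

/-- If compactly supported smooth functions are moved to `+∞` by composition with large negative
powers of `e`, to `-∞` by large positive ones, and tend to zero in both directions, then there is a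
function in `𝒪_M(ℝ)` whose orbit comes arbitrarily close to a given sequence of such functions. -/
theorem exists_orbit_approximating (e : Equiv.Perm ℝ) (hsm : ∀ z : ℤ, ContDiff ℝ ∞ ⇑(e ^ z))
    {s : ℕ → ℕ}
    (hback : ∀ j, ∀ f : ℝ → 𝕜, ContDiff ℝ ∞ f → ∀ r, (∀ x, r < |x| → f x = 0) → ∀ ε > 0,
      ∀ᶠ n : ℕ in atTop, ∀ x,
        ‖iteratedDeriv j (f ∘ ⇑(e ^ (-(n : ℤ)))) x‖ ≤ ε * (1 + |x| ^ 2) ^ s j)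
    (hforw : ∀ j, ∀ f : ℝ → 𝕜, ContDiff ℝ ∞ f → ∀ r, (∀ x, r < |x| → f x = 0) → ∀ ε > 0,
      ∀ᶠ n : ℕ in atTop, ∀ x, ‖iteratedDeriv j (f ∘ ⇑(e ^ (n : ℤ))) x‖ ≤ ε * (1 + |x| ^ 2) ^ s j)
    (hesc : ∀ r L : ℝ, ∀ᶠ n : ℕ in atTop, ∀ x ≤ L, r < |(e ^ (-(n : ℤ))) x|)
    {d : ℕ → ℝ → 𝕜} (hd : ∀ k, ContDiff ℝ ∞ (d k)) (hd0 : ∀ k, ∃ r : ℝ, ∀ x, r < |x| → d k x = 0) :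
    ∃ g : ℝ → 𝕜, g.HasTemperateGrowth ∧
      ∃ N : ℕ → ℕ, IsNull (fun k => g ∘ ⇑(e ^ (N k : ℤ)) - d k) := by
  choose r hr using hd0
  -- The bound `(1 / 4) ^ k` splits later into `(1 / 2) ^ k * (1 / 2) ^ l`: one factor tends to
  -- zero, the other is summable in `l`.
  have hthr : ∀ k : ℕ, ∃ T : ℕ, ∀ n ≥ T, (∀ x ≤ (k : ℝ), d k ((e ^ (-(n : ℤ))) x) = 0) ∧
      (∀ j ∈ Finset.range (k + 1), ∀ x,
        ‖iteratedDeriv j (d k ∘ ⇑(e ^ (-(n : ℤ)))) x‖ ≤ (1 / 4) ^ k * (1 + |x| ^ 2) ^ s j) ∧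
      ∀ l ∈ Finset.range k, ∀ j ∈ Finset.range (k + 1), ∀ x,
        ‖iteratedDeriv j (d l ∘ ⇑(e ^ (n : ℤ))) x‖ ≤ (1 / 4) ^ k * (1 + |x| ^ 2) ^ s j := fun k => by
    refine eventually_atTop.1 (Eventually.and ?_ (Eventually.and ?_ ?_))
    · filter_upwards [hesc (r k) k] with n hn x hx using hr k _ (hn x hx)
    · exact (Finset.eventually_all _).2 fun j _ =>
        hback j (d k) (hd k) (r k) (hr k) _ (by positivity)
    · exact (Finset.eventually_all _).2 fun l _ => (Finset.eventually_all _).2 fun j _ =>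
        hforw j (d l) (hd l) (r l) (hr l) _ (by positivity)
  choose T hT0 hTb hTf using hthr
  -- Partial sums make every gap `N k - N l` with `l < k` at least `T k`.
  let N : ℕ → ℕ := fun k => ∑ i ∈ Finset.range (k + 1), T i
  have hTN : ∀ k, T k ≤ N k := fun k =>
    Finset.single_le_sum (fun _ _ => Nat.zero_le _) (Finset.self_mem_range_succ k)
  have hN : ∀ l k, l < k → N l + T k ≤ N k := fun l k hlk => by
    simp only [N]
    rw [Finset.sum_range_succ _ k]
    gcongr
    omega
  let u : ℕ → ℝ → 𝕜 := fun k => d k ∘ ⇑(e ^ (-(N k : ℤ)))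
  have hu0 : ∀ (k : ℕ) (x : ℝ), x ≤ k → u k x = 0 := fun k x hx => hT0 k _ (hTN k) x hx
  have husm : ∀ k, ContDiff ℝ ∞ (u k) := fun k => (hd k).comp (hsm _)
  refine ⟨locSum u, hasTemperateGrowth_locSum hu0 husm (fun k j => ?_) (s := s) ?_, N, ?_⟩
  · refine exists_bound_of_vanishing_off (husm k)
      ((isCompact_Icc (a := -r k) (b := r k)).image (hsm (N k)).continuous) (fun x hx => ?_) j
    refine hr k _ (not_le.1 fun h => hx ⟨(e ^ (-(N k : ℤ))) x, abs_le.1 h, ?_⟩)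
    rw [← Equiv.Perm.mul_apply, ← zpow_add]
    simp
  · intro k j hj x
    refine (hTb k (N k) (hTN k) j (by simpa [Nat.lt_succ_iff] using hj) x).trans ?_
    gcongr
    norm_num
  · intro j
    refine ⟨s j, fun ε hε => ?_⟩
    have hlim : Tendsto (fun k : ℕ => (1 / 2 : ℝ) ^ k * 2) atTop (𝓝 (0 * 2)) :=
      (tendsto_pow_atTop_nhds_zero_of_lt_one (by norm_num) (by norm_num)).mul_const 2
    rw [zero_mul] at hlim
    filter_upwards [hlim.eventually_lt_const hε, eventually_ge_atTop j] with k hk hjk x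
    obtain ⟨K, hK⟩ := exists_nat_gt ((e ^ (N k : ℤ)) x)
    have hK' : (e ^ (N k : ℤ)) x < ((K + k + 1 : ℕ) : ℝ) :=
      hK.trans_le (by push_cast; linarith [(Nat.cast_nonneg k : (0 : ℝ) ≤ k)])
    have hmem : k ∈ Finset.range (K + k + 1) := Finset.mem_range.2 (by omega)
    -- Composing with `e ^ N k` turns the `l`-th term into `d l ∘ e ^ (N k - N l)`; the term `l = k`
    -- cancels against `d k`.
    have hev : ∀ᶠ y in 𝓝 x, (locSum u ∘ ⇑(e ^ (N k : ℤ)) - d k) y =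
        ∑ l ∈ (Finset.range (K + k + 1)).erase k, (d l ∘ ⇑(e ^ ((N k : ℤ) - N l))) y := by
      filter_upwards [((hsm (N k)).continuous.tendsto x).eventually
        (eventually_locSum_eq hu0 (Nat.succ_ne_zero _) hK')] with y hy
      have hterm : ∀ l, u l ((e ^ (N k : ℤ)) y) = (d l ∘ ⇑(e ^ ((N k : ℤ) - N l))) y := fun l => by
        simp only [u, Function.comp_apply]
        rw [← Equiv.Perm.mul_apply, ← zpow_add, neg_add_eq_sub]
      rw [Pi.sub_apply, Function.comp_apply, hy, ← Finset.add_sum_erase _ _ hmem]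
      simp only [hterm]
      simp
    refine (norm_iteratedDeriv_sum_le (fun l => (hd l).comp (hsm _)) hev j).trans ?_
    have hquarter : ∀ i, (1 / 4 : ℝ) ^ i = (1 / 2) ^ i * (1 / 2) ^ i := fun i => by
      rw [← mul_pow]; norm_num
    have hterm : ∀ l ∈ (Finset.range (K + k + 1)).erase k,
        ‖iteratedDeriv j (d l ∘ ⇑(e ^ ((N k : ℤ) - N l))) x‖ ≤
          (1 / 2) ^ k * (1 / 2) ^ l * (1 + |x| ^ 2) ^ s j := fun l hl => by
      -- Earlier terms have moved forward by at least `T k`, later ones are still moved back by at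
      -- least `T l`.
      rcases lt_or_gt_of_ne (Finset.ne_of_mem_erase hl) with hlk | hlk
      · have h1 := hN l k hlk
        have h2 : (N k : ℤ) - N l = ((N k - N l : ℕ) : ℤ) := by omega
        rw [h2]
        refine (hTf k _ (by omega) l (Finset.mem_range.2 hlk) j (Finset.mem_range.2 (by omega))
          x).trans ?_
        rw [hquarter]
        gcongr ?_ * ?_ * _
        exact pow_le_pow_of_le_one (by norm_num) (by norm_num) hlk.le
      · have h1 := hN k l hlk
        have h2 : (N k : ℤ) - N l = -((N l - N k : ℕ) : ℤ) := by omega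
        rw [h2]
        refine (hTb l _ (by omega) j (Finset.mem_range.2 (by omega)) x).trans ?_
        rw [hquarter]
        gcongr ?_ * ?_ * _
        exact pow_le_pow_of_le_one (by norm_num) (by norm_num) hlk.le
    refine (Finset.sum_le_sum hterm).trans ?_
    rw [← Finset.sum_mul, ← Finset.mul_sum]
    gcongr
    refine le_trans ?_ hk.le
    gcongr
    exact (Finset.sum_le_sum_of_subset_of_nonneg (Finset.erase_subset _ _)
      fun _ _ _ => by positivity).trans (sum_geometric_two_le _)

end universal

/-! ### Dynamics and smoothness of the iterates -/

section iterates

/-- Negative powers rest on the inverse function theorem: the derivative of `e` never vanishes and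
`e`, an increasing bijection, is a homeomorphism. -/
theorem contDiff_zpow {e : Equiv.Perm ℝ} (he : ContDiff ℝ ∞ e) (hpos : ∀ x, 0 < deriv e x) (z : ℤ) :
    ContDiff ℝ ∞ ⇑(e ^ z) := by
  have hmono : StrictMono e := strictMono_of_deriv_pos hpos
  have hinv : ContDiff ℝ ∞ ⇑e⁻¹ := by
    let h : ℝ ≃ₜ ℝ := (hmono.orderIsoOfSurjective e e.surjective).toHomeomorph
    have := h.contDiff_symm_deriv (f' := deriv e) (n := ∞) (fun x => (hpos x).ne')
      (fun x => ((he.differentiable (by simp)) x).hasDerivAt) he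
    suffices heq : ⇑e⁻¹ = h.symm from heq ▸ this
    funext x
    refine e.injective ?_
    exact (e.apply_symm_apply x).trans (h.apply_symm_apply x).symm
  have hpow : ∀ {f : Equiv.Perm ℝ}, ContDiff ℝ ∞ f → ∀ n : ℕ, ContDiff ℝ ∞ ⇑(f ^ n) := by
    intro f hf n
    induction n with
    | zero => exact contDiff_id
    | succ n ih => exact ih.comp hf
  rcases Int.eq_nat_or_neg z with ⟨n, rfl | rfl⟩
  · simpa using hpow he n
  · simpa using hpow hinv n

/-- The forward orbits of an increasing continuous bijection without fixed points that moves every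
point to the right tend to infinity. -/
theorem tendsto_pow_apply_atTop {e : Equiv.Perm ℝ} (hc : Continuous e) (hgt : ∀ x, x < e x) (x : ℝ) :
    Tendsto (fun n : ℕ => (e ^ n) x) atTop atTop := by
  simp only [Equiv.Perm.coe_pow]
  have hmono : Monotone fun n : ℕ => (⇑e)^[n] x := monotone_nat_of_le_succ fun n => by
    rw [Function.iterate_succ_apply']
    exact (hgt _).le
  -- A convergent orbit would have a fixed point as its limit.
  refine (tendsto_atTop_of_monotone hmono).resolve_right ?_
  rintro ⟨l, hl⟩
  exact (hgt l).ne' (isFixedPt_of_tendsto_iterate hl hc.continuousAt)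

theorem strictMono_pow {e : Equiv.Perm ℝ} (h : StrictMono e) (n : ℕ) : StrictMono ⇑(e ^ n) := by
  rw [Equiv.Perm.coe_pow]
  exact h.iterate n

/-- From `-r ≤ e⁻ⁿ x` follows `eⁿ (-r) ≤ x`, and the orbit of `-r` tends to infinity. -/
theorem eventually_lt_of_abs_zpow_neg_le {e : Equiv.Perm ℝ} (hc : Continuous e) (hm : StrictMono e)
    (hgt : ∀ x, x < e x) (r L : ℝ) :
    ∀ᶠ n : ℕ in atTop, ∀ x, |(e ^ (-(n : ℤ))) x| ≤ r → L < x := by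
  filter_upwards [(tendsto_pow_apply_atTop hc hgt (-r)).eventually_gt_atTop L] with n hn x hx
  refine hn.trans_le (((strictMono_pow hm n).monotone (abs_le.1 hx).1).trans_eq ?_)
  simp

/-- Once the orbit of `L` has passed `r`, monotonicity carries every `x ≥ L` beyond `r` too. -/
theorem eventually_lt_of_abs_zpow_le {e : Equiv.Perm ℝ} (hc : Continuous e) (hm : StrictMono e)
    (hgt : ∀ x, x < e x) (r L : ℝ) :
    ∀ᶠ n : ℕ in atTop, ∀ x, |(e ^ (n : ℤ)) x| ≤ r → x < L := by
  filter_upwards [(tendsto_pow_apply_atTop hc hgt L).eventually_gt_atTop r] with n hn x hx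
  rw [zpow_natCast] at hx
  exact (strictMono_pow hm n).lt_iff_lt.1 ((abs_le.1 hx).2.trans_lt hn)

theorem compositionOperator_pow_apply {𝕜 : Type*} [RCLike 𝕜] {ψ : ℝ → ℝ}
    (hψ : ψ ∈ omSubmodule ℝ) (n : ℕ) (g : OM 𝕜) :
    ((compositionOperator 𝕜 ψ hψ ^ n) g).1 = g.1 ∘ ψ^[n] := by
  induction n generalizing g with
  | zero => rfl
  | succ n ih =>
    rw [pow_succ, Module.End.mul_apply, ih, Function.iterate_succ']
    rfl

end iterates

end SlowlyIncreasing

/-! ### The theorem -/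

open SlowlyIncreasing in
theorem theorem2p2 {𝕜 : Type*} [RCLike 𝕜] (ψ : ℝ → ℝ)
    (hψ : ψ ∈ SlowlyIncreasing.omSubmodule ℝ) (hbij : Function.Bijective ψ)
    (hgt : ∀ x, x < ψ x) (hderiv : ∀ x, 0 < deriv ψ x) (α β : ℝ)
    (hback : ∀ j : ℕ, 1 ≤ j → ∃ C : ℝ, 0 < C ∧ ∃ t : ℕ, ∀ x ∈ Set.Ioi β, ∀ n : ℕ, 1 ≤ n →
      |iteratedDeriv j (SlowlyIncreasing.iter ψ hbij (-(n : ℤ))) x| ≤ C * (1 + |x| ^ 2) ^ t)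
    (hforw : ∀ j : ℕ, 1 ≤ j → ∃ C : ℝ, 0 < C ∧ ∃ t : ℕ, ∀ x ∈ Set.Iio α, ∀ n : ℕ, 1 ≤ n →
      |iteratedDeriv j (SlowlyIncreasing.iter ψ hbij (n : ℤ)) x| ≤ C * (1 + |x| ^ 2) ^ t) :
    SlowlyIncreasing.IsSeqHypercyclic (SlowlyIncreasing.compositionOperator 𝕜 ψ hψ) := by
  set e : Equiv.Perm ℝ := Equiv.ofBijective ψ hbij
  have hψsm : ContDiff ℝ ∞ e := ((mem_omSubmodule_iff ψ).1 hψ).1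
  have hsm := contDiff_zpow hψsm hderiv
  have hmono : StrictMono e := strictMono_of_deriv_pos hderiv
  have hright := eventually_lt_of_abs_zpow_neg_le hψsm.continuous hmono hgt
  have hleft := eventually_lt_of_abs_zpow_le hψsm.continuous hmono hgt
  choose s hs using exists_eventually_comp_le 𝕜 (φ := fun n : ℕ => iter ψ hbij (-(n : ℤ)))
    (fun n => hsm _) hback fun r L => by
      filter_upwards [hright r (max β L)] with n hn x hx
      have := max_lt_iff.1 (hn x hx)
      exact ⟨this.1, this.2.le.trans (le_abs_self x)⟩
  choose s' hs' using exists_eventually_comp_le 𝕜 (φ := fun n : ℕ => iter ψ hbij (n : ℤ))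
    (fun n => hsm _) hforw fun r L => by
      filter_upwards [hleft r (min α (-L))] with n hn x hx
      have := lt_min_iff.1 (hn x hx)
      exact ⟨this.1, (le_neg.1 this.2.le).trans (neg_le_abs x)⟩
  obtain ⟨d, hd, hd0, hdense⟩ := exists_seq_dense 𝕜
  obtain ⟨g, hg, N, hN⟩ := exists_orbit_approximating e hsm (s := fun j => max (s j) (s' j))
    (fun j f hf r hr ε hε => (hs j f hf r hr ε hε).mono fun n hn x => (hn x).trans (by
      gcongr ε * ?_
      exact one_add_sq_pow_mono x (le_max_left _ _)))
    (fun j f hf r hr ε hε => (hs' j f hf r hr ε hε).mono fun n hn x => (hn x).trans (by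
      gcongr ε * ?_
      exact one_add_sq_pow_mono x (le_max_right _ _)))
    (fun r L => (hright r L).mono fun n hn x hx => not_le.1 fun h => absurd (hn x h) hx.not_gt)
    hd hd0
  obtain ⟨G, rfl⟩ : ∃ G : OM 𝕜, G.1 = g := ⟨⟨g, (mem_omSubmodule_iff g).2 hg⟩, rfl⟩
  refine ⟨G, Set.eq_univ_of_forall fun f => ?_⟩
  obtain ⟨a, ha, hda⟩ := hdense f.1 f.hasTemperateGrowth
  refine ⟨fun i => (compositionOperator 𝕜 ψ hψ ^ N (a i)) G, fun i => ⟨N (a i), rfl⟩,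
    IsNull.tendsto ?_⟩
  -- Split the error as `(g ∘ ψ_{N (a i)} - d (a i)) + (d (a i) - f)`; the first part is null
  -- because `a i → ∞`.
  have := (hN.comp_tendsto ha).add hda (fun i => (hg.1.comp (hsm _)).sub (hd _))
    (fun i => (hd _).sub f.hasTemperateGrowth.1)
  convert this using 2 with i
  rw [compositionOperator_pow_apply, zpow_natCast, Equiv.Perm.coe_pow, sub_add_sub_cancel]
  rfl
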